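/- An \emph{ai-semiring} is a set $S$ with two binary operations $+$ and $\cdot$ such that $(S,+)$ is a commutative idempotent semigroup, $(S,\cdot)$ is a semigroup, and both distributive laws $(x+y)z=xz+yz$ and $x(y+z)=xy+xz$ hold. A \emph{variety} is a class of algebras $(A,+,\cdot)$ with two binary operations that is closed under homomorphic images, subalgebras and arbitrary direct products. An algebra $A$ is \emph{nonfinitely based} if the variety generated by $A$ cannot be defined by finitely many identities. Let $S_{(4,84)}$, $S_{(4,94)}$, $S_{(4,117)}$, $S_{(4,173)}$, $S_{(4,282)}$ be the algebras with carrier $\{\infty,a,1,b\}$ whose operations have the following Cayley tables (rows and columns in the order $\infty,a,1,b$). Addition in $S_{(4,84)}$, $S_{(4,94)}$, $S_{(4,117)}$ and $S_{(4,173)}$, and addition in $S_{(4,282)}$, are respectively $$\begin{pmatrix}\infty&\infty&\infty&\infty\\ \infty&a&\infty&\infty\\ \infty&\infty&1&b\\ \infty&\infty&b&b\end{pmatrix},\qquad \begin{pmatrix}\infty&\infty&\infty&b\\ \infty&a&\infty&b\\ \infty&\infty&1&b\\ b&b&b&b\end{pmatrix}.$$ Multiplication in $S_{(4,84)}$ and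 in $S_{(4,282)}$, in $S_{(4,94)}$, in $S_{(4,117)}$, and in $S_{(4,173)}$, is respectively $$\begin{pmatrix}\infty&\infty&\infty&\infty\\ \infty&\infty&a&\infty\\ \infty&a&1&\infty\\ \infty&\infty&\infty&\infty\end{pmatrix},\quad \begin{pmatrix}\infty&\infty&\infty&\infty\\ \infty&\infty&a&\infty\\ \infty&a&1&\infty\\ \infty&\infty&b&\infty\end{pmatrix},\quad \begin{pmatrix}\infty&\infty&\infty&\infty\\ \infty&\infty&a&\infty\\ \infty&a&1&b\\ \infty&\infty&\infty&\infty\end{pmatrix},\quad \begin{pmatrix}\infty&\infty&\infty&\infty\\ \infty&\infty&a&a\\ \infty&a&1&1\\ \infty&a&1&1\end{pmatrix}.$$ Then each of $S_{(4,84)}$, $S_{(4,94)}$, $S_{(4,117)}$, $S_{(4,173)}$ and $S_{(4,282)}$ is an ai-semiring and is nonfinitely based. -/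

import Mathlib

/-- An algebra of the semiring signature: a nonempty set with two binary operations. -/
structure SAlg : Type 1 where
  carrier : Type
  add : carrier → carrier → carrier
  mul : carrier → carrier → carrier
  nonempty : Nonempty carrier

namespace SAlg

/-- Additively idempotent semirings: a commutative idempotent semigroup under `add`,
a semigroup under `mul`, and both distributive laws. -/
structure IsAiSemiring (A : SAlg) : Prop where
  add_assoc : ∀ x y z, A.add (A.add x y) z = A.add x (A.add y z)
  add_comm : ∀ x y, A.add x y = A.add y x
  add_idem : ∀ x, A.add x x = x
  mul_assoc : ∀ x y z, A.mul (A.mul x y) z = A.mul x (A.mul y z)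
  right_distrib : ∀ x y z, A.mul (A.add x y) z = A.add (A.mul x z) (A.mul y z)
  left_distrib : ∀ x y z, A.mul x (A.add y z) = A.add (A.mul x y) (A.mul x z)

/-- Homomorphisms. -/
structure IsHom (A B : SAlg) (f : A.carrier → B.carrier) : Prop where
  map_add : ∀ x y, f (A.add x y) = B.add (f x) (f y)
  map_mul : ∀ x y, f (A.mul x y) = B.mul (f x) (f y)

/-- Direct products, with componentwise operations. -/
def prod {ι : Type} (A : ι → SAlg) : SAlg where
  carrier := ∀ i, (A i).carrier
  add x y := fun i => (A i).add (x i) (y i)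
  mul x y := fun i => (A i).mul (x i) (y i)
  nonempty := ⟨fun i => Classical.choice (A i).nonempty⟩

/-- A variety: a class of algebras closed under homomorphic images, subalgebras (up to
isomorphism, i.e. algebras that embed) and arbitrary direct products. -/
structure IsVariety (K : Set SAlg) : Prop where
  image : ∀ A ∈ K, ∀ (B : SAlg) (f : A.carrier → B.carrier),
    IsHom A B f → Function.Surjective f → B ∈ K
  sub : ∀ A ∈ K, ∀ (B : SAlg) (f : B.carrier → A.carrier),
    IsHom B A f → Function.Injective f → B ∈ K
  prod : ∀ (ι : Type) (A : ι → SAlg), (∀ i, A i ∈ K) → SAlg.prod A ∈ K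

/-- The variety generated by `A`: the least variety containing `A`. -/
def varietyGen (A : SAlg) : Set SAlg :=
  ⋂₀ {K | IsVariety K ∧ A ∈ K}

theorem isVariety_varietyGen (A : SAlg) : IsVariety (varietyGen A) where
  image := fun C hC B f hf hs K hK => hK.1.image C (hC K hK) B f hf hs
  sub := fun C hC B f hf hi K hK => hK.1.sub C (hC K hK) B f hf hi
  prod := fun ι C hC K hK => hK.1.prod ι C (fun i => hC i K hK)

theorem mem_varietyGen (A : SAlg) : A ∈ varietyGen A := fun _ hK => hK.2

/-- Terms in the semiring signature over countably many variables. -/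
inductive Term : Type
  | var : ℕ → Term
  | add : Term → Term → Term
  | mul : Term → Term → Term

/-- The value of a term under an assignment of the variables. -/
def eval (A : SAlg) (v : ℕ → A.carrier) : Term → A.carrier
  | Term.var n => v n
  | Term.add s t => A.add (A.eval v s) (A.eval v t)
  | Term.mul s t => A.mul (A.eval v s) (A.eval v t)

/-- `A` satisfies the identity `e.1 ≈ e.2`. -/
def Satisfies (A : SAlg) (e : Term × Term) : Prop :=
  ∀ v : ℕ → A.carrier, A.eval v e.1 = A.eval v e.2

/-- A class of algebras is finitely based if it is defined by finitely many identities. -/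
def ClassFinitelyBased (K : Set SAlg) : Prop :=
  ∃ E : Set (Term × Term), E.Finite ∧ K = {B | ∀ e ∈ E, B.Satisfies e}

/-- An algebra is nonfinitely based if the variety that it generates is not finitely based. -/
def IsNonfinitelyBased (A : SAlg) : Prop :=
  ¬ ClassFinitelyBased (varietyGen A)

end SAlg

/-- The carrier set `{∞, a, 1, b}`. -/
inductive Elt : Type
  | infty
  | a
  | one
  | b

namespace Elt

/-- A function on `{∞, a, 1, b}` given by its four values, listed in this order. -/
def tab {α : Type} (w x y z : α) : Elt → α
  | infty => w
  | a => x
  | one => y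
  | b => z

/-- Addition of `S84`, `S94`, `S117` and `S173`: the Cayley table by rows, with rows and columns
in the order `∞, a, 1, b`. -/
def add₁ : Elt → Elt → Elt := tab
  (tab infty infty infty infty)
  (tab infty a     infty infty)
  (tab infty infty one   b)
  (tab infty infty b     b)

/-- Addition of `S282`. -/
def add₂ : Elt → Elt → Elt := tab
  (tab infty infty infty b)
  (tab infty a     infty b)
  (tab infty infty one   b)
  (tab b     b     b     b)

def S84 : SAlg where
  carrier := Elt
  nonempty := ⟨infty⟩
  add := add₁
  mul := tab
    (tab infty infty infty infty)
    (tab infty infty a     infty)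
    (tab infty a     one   infty)
    (tab infty infty infty infty)

def S94 : SAlg where
  carrier := Elt
  nonempty := ⟨infty⟩
  add := add₁
  mul := tab
    (tab infty infty infty infty)
    (tab infty infty a     infty)
    (tab infty a     one   infty)
    (tab infty infty b     infty)

def S117 : SAlg where
  carrier := Elt
  nonempty := ⟨infty⟩
  add := add₁
  mul := tab
    (tab infty infty infty infty)
    (tab infty infty a     infty)
    (tab infty a     one   b)
    (tab infty infty infty infty)

def S173 : SAlg where
  carrier := Elt
  nonempty := ⟨infty⟩
  add := add₁
  mul := tab
    (tab infty infty infty infty)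
    (tab infty infty a     a)
    (tab infty a     one   one)
    (tab infty a     one   one)

def S282 : SAlg where
  carrier := Elt
  nonempty := ⟨infty⟩
  add := add₂
  mul := tab
    (tab infty infty infty infty)
    (tab infty infty a     infty)
    (tab infty a     one   infty)
    (tab infty infty infty infty)

end Elt

/-! The obstruction is a family of 3-uniform hypergraphs that are locally trees but have no global
exact hitting set. The points are the elements of a finite group `G`, and each `g` gives the line
`{g * ρ 0, g * ρ 1, g * ρ 2}`, with the `ρ i` involutions. If there are no short relations, a small
set of lines is a forest, and exact hitting sets of it can be built leaf by leaf with prescribed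
values at two points (`exists_exactOn`). Globally there is none when 3 does not divide the order of
`G`, since an exact hitting set would have `|G| / 3` points.

All five algebras contain the flat algebra `{∞, a, 1}`, where a product of three elements is `a`
exactly when one factor is `a` and the others are `1`. Thus a sum over all lines of products of
their points can take the value `a` only if the variables with value `a` form an exact hitting set.
So this sum avoids `a`; made cyclic, it also avoids `b`. Its values are then the idempotents `∞` and
`1`, and every one of the five algebras satisfies `t ≈ t * t` for this sum `t`.

The algebra `hypAlg ρ` violates this law: there `t` can be `a`, with `a * a = ∞`. Yet evaluating a
short term involves few lines, and hitting sets of those give enough maps to the flat algebra to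
transfer its short identities (`hypAlg_satisfies`). A finite basis would consist of such identities,
hence would put `hypAlg ρ` into the variety. -/

/-- Words in three letters without immediate repetitions and of length at most `m` do not
evaluate to the identity under `ρ`. -/
def NoShortRelation {G : Type} [Group G] (ρ : Fin 3 → G) (m : ℕ) : Prop :=
  ∀ l : List (Fin 3), l.IsChain (· ≠ ·) → l ≠ [] → l.length ≤ m → (l.map ρ).prod ≠ 1

/-! ### 2-groups of units congruent to 1 modulo 2 -/

section CongruenceGroup

/-- The units of a ring that are congruent to `1` modulo `2`. -/
def congruenceSubgroup (R : Type) [Ring R] : Subgroup Rˣ where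
  carrier := {u | ∃ a : R, (u : R) = 1 + 2 * a}
  one_mem' := ⟨0, by simp⟩
  mul_mem' := by
    rintro u v ⟨a, ha⟩ ⟨b, hb⟩
    refine ⟨a + b + 2 * (a * b), ?_⟩
    rw [Units.val_mul, ha, hb]
    noncomm_ring
  inv_mem' := by
    rintro u ⟨a, ha⟩
    refine ⟨-(a * (u⁻¹ : Rˣ)), ?_⟩
    have h : (u : R) * (u⁻¹ : Rˣ) = 1 := u.mul_inv
    rw [ha] at h
    rw [← sub_eq_zero]
    rw [← sub_eq_zero] at h
    rw [← h]
    noncomm_ring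

/-- Each squaring gains one factor 2. The ring may be noncommutative, but `2 ^ n` commutes with
everything. -/
theorem exists_pow_two_pow_eq {R : Type} [Ring R] (a : R) (n : ℕ) :
    ∃ b : R, (1 + 2 * a) ^ 2 ^ n = 1 + 2 ^ (n + 1) * b := by
  induction n with
  | zero => exact ⟨a, by simp⟩
  | succ n ih =>
    obtain ⟨b, hb⟩ := ih
    refine ⟨b + 2 ^ n * (b * b), ?_⟩
    have hc : Commute ((2 : R) ^ n) b := (Commute.ofNat_left 2 b).pow_left n
    rw [pow_succ, pow_mul, hb, pow_succ (2 : R) (n + 1), pow_succ (2 : R) n]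
    generalize (2 : R) ^ n = c at *
    have h2 : c * 2 * b * (c * 2 * b) = 4 * (c * (c * (b * b))) := by
      calc c * 2 * b * (c * 2 * b) = 4 * (c * (b * c) * b) := by noncomm_ring
        _ = _ := by rw [← hc.eq]; noncomm_ring
    calc (1 + c * 2 * b) ^ 2 = 1 + 2 * (c * 2 * b) + c * 2 * b * (c * 2 * b) := by noncomm_ring
      _ = _ := by rw [h2]; noncomm_ring

theorem isPGroup_congruenceSubgroup {R : Type} [Ring R] {N : ℕ} (h : (2 : R) ^ N = 0) :
    IsPGroup 2 (congruenceSubgroup R) := by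
  rintro ⟨u, a, ha⟩
  refine ⟨N, ?_⟩
  obtain ⟨b, hb⟩ := exists_pow_two_pow_eq a N
  ext
  simp [ha, hb, pow_succ, h]

end CongruenceGroup

/-! ### Reflections with a growing integral orbit -/

section Reflections

/-- The orbit of `(1, 1, 1)` under the reflections that replace the coordinate `x i` by
`2 * (x j + x k) - x i`. -/
def reflectionOrbit : List (Fin 3) → Fin 3 → ℤ
  | [] => 1
  | a :: l => Function.update (reflectionOrbit l) a
      (2 * (∑ i, reflectionOrbit l i) - 3 * reflectionOrbit l a)

/-- The coordinate changed last is strictly the largest. Reflecting in another one replaces `x a` by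
`2 * (x b + x k) - x a`, which exceeds both remaining coordinates because `x b > x a`, and is at
most four times the previous bound. This growth excludes relations, and the bound says how large a
modulus preserves it. -/
theorem reflectionOrbit_cons (a : Fin 3) (l : List (Fin 3)) (h : (a :: l).IsChain (· ≠ ·)) :
    (∀ i, 1 ≤ reflectionOrbit (a :: l) i) ∧
    (∀ i ≠ a, reflectionOrbit (a :: l) i < reflectionOrbit (a :: l) a) ∧
    (∀ i, reflectionOrbit (a :: l) i ≤ 4 ^ (l.length + 1)) := by
  induction l generalizing a with
  | nil =>
    fin_cases a <;>
      simp [reflectionOrbit, Fin.forall_fin_succ, Function.update_apply]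
  | cons b l ih =>
    rw [List.isChain_cons_cons] at h
    obtain ⟨h1, h2, h3⟩ := ih b h.2
    have hab := h.1
    rw [reflectionOrbit]
    generalize reflectionOrbit (b :: l) = x at *
    have e : (4 : ℤ) ^ ((b :: l).length + 1) = 4 * 4 ^ (l.length + 1) := by
      rw [List.length_cons, pow_succ]; ring
    rw [e]
    generalize (4 : ℤ) ^ (l.length + 1) = M at *
    simp only [Fin.forall_fin_succ, Fin.sum_univ_three, Fin.isValue, Fin.succ_zero_eq_one,
      Fin.succ_one_eq_two, IsEmpty.forall_iff, and_true] at *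
    fin_cases a <;> fin_cases b <;> simp at * <;> omega

/-- The `i`-th reflection, as a matrix. -/
def reflection (R : Type) [CommRing R] (i : Fin 3) : Matrix (Fin 3) (Fin 3) R :=
  1 + 2 * Matrix.of fun j k => if j = i then (if k = i then -1 else 1) else 0

theorem reflection_mul_self (R : Type) [CommRing R] (i : Fin 3) :
    reflection R i * reflection R i = 1 := by
  set A : Matrix (Fin 3) (Fin 3) R :=
    Matrix.of fun j k => if j = i then (if k = i then -1 else 1) else 0 with hA
  have h : A * A = -A := by
    ext j k
    fin_cases i <;> fin_cases j <;> fin_cases k <;>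
      simp [hA, Matrix.mul_apply]
  calc (1 + 2 * A) * (1 + 2 * A) = 1 + 4 * A + 4 * (A * A) := by noncomm_ring
    _ = 1 := by rw [h]; noncomm_ring

theorem reflection_mulVec (R : Type) [CommRing R] (i : Fin 3) (x : Fin 3 → R) :
    (reflection R i).mulVec x = Function.update x i (2 * (∑ j, x j) - 3 * x i) := by
  have h2 : (2 : Matrix (Fin 3) (Fin 3) R) = (2 : R) • 1 := by
    rw [two_smul, one_add_one_eq_two]
  rw [reflection, h2, smul_mul_assoc, one_mul]
  ext j
  fin_cases i <;> fin_cases j <;>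
    simp [Matrix.mulVec, dotProduct, Fin.sum_univ_three, Matrix.one_apply] <;> ring

theorem prod_reflection_mulVec (R : Type) [CommRing R] (l : List (Fin 3)) :
    ((l.map (reflection R)).prod).mulVec 1 = fun i => (reflectionOrbit l i : R) := by
  induction l with
  | nil => ext; simp [reflectionOrbit]
  | cons a l ih =>
    rw [List.map_cons, List.prod_cons, ← Matrix.mulVec_mulVec, ih, reflection_mulVec]
    ext i
    rw [reflectionOrbit]
    by_cases h : i = a
    · subst h; simp
    · simp [Function.update_of_ne h]

end Reflections

/-- There are finite groups of order prime to `3` that are generated by three involutions without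
short relations. -/
theorem exists_involutions_noShortRelation (m : ℕ) :
    ∃ (G : Type) (_ : Group G) (_ : Fintype G) (ρ : Fin 3 → G),
      (∀ i, ρ i * ρ i = 1) ∧ NoShortRelation ρ m ∧ ¬ 3 ∣ Fintype.card G := by
  classical
  -- After at most `m` reflections the coordinates lie between 1 and `4 ^ m`, below this modulus, so
  -- a coordinate different from 1 stays different after reduction.
  let K := ZMod (2 ^ (2 * m + 1))
  have : NeZero (2 ^ (2 * m + 1)) := ⟨by positivity⟩
  let R := Matrix (Fin 3) (Fin 3) K
  have hR : (2 : R) ^ (2 * m + 1) = 0 := by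
    have h : ((2 : K)) ^ (2 * m + 1) = 0 := by
      have := ZMod.natCast_self (2 ^ (2 * m + 1))
      push_cast at this
      exact this
    have h2 : (2 : R) = algebraMap K R 2 := (map_ofNat _ 2).symm
    rw [h2, ← map_pow, h, map_zero]
  let r : Fin 3 → Rˣ := fun i =>
    ⟨reflection K i, reflection K i, reflection_mul_self K i, reflection_mul_self K i⟩
  let ρ : Fin 3 → congruenceSubgroup R := fun i => ⟨r i, _, rfl⟩
  have : Finite Rˣ := inferInstance
  let _ : Fintype (congruenceSubgroup R) := Fintype.ofFinite _
  refine ⟨congruenceSubgroup R, inferInstance, inferInstance, ρ, ?_, ?_, ?_⟩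
  · intro i
    ext1
    ext1
    exact reflection_mul_self K i
  · intro l hl hne hlen hprod
    have h1 : (l.map (reflection K)).prod = 1 := by
      have h := congrArg (fun u : congruenceSubgroup R => ((u : Rˣ) : R)) hprod
      have h' := map_list_prod ((Units.coeHom R).comp (congruenceSubgroup R).subtype) (l.map ρ)
      rw [List.map_map] at h'
      exact h'.symm.trans h
    have h2 := prod_reflection_mulVec K l
    rw [h1, Matrix.one_mulVec] at h2
    obtain ⟨a, l, rfl⟩ := List.exists_cons_of_ne_nil hne
    obtain ⟨h3, h4, h5⟩ := reflectionOrbit_cons a l hl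
    have h6 := congrFun h2 a
    have h7 : ((reflectionOrbit (a :: l) a - 1 : ℤ) : K) = 0 := by
      push_cast; rw [← h6]; simp
    rw [ZMod.intCast_zmod_eq_zero_iff_dvd] at h7
    have h8 : 1 < reflectionOrbit (a :: l) a := by
      have hb : a + 1 ≠ a := by fin_cases a <;> decide
      have := h4 _ hb
      have := h3 (a + 1)
      omega
    have h9 := Int.le_of_dvd (by omega) h7
    have h10 : (4 : ℤ) ^ (l.length + 1) ≤ 4 ^ m := pow_le_pow_right₀ (by norm_num) hlen
    have h11 := h5 a
    have h12 : ((2 ^ (2 * m + 1) : ℕ) : ℤ) = 4 ^ m * 2 := by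
      push_cast; rw [pow_succ, pow_mul]; norm_num
    have h13 : (0 : ℤ) < 4 ^ m := by positivity
    omega
  · have : Fact (Nat.Prime 2) := ⟨Nat.prime_two⟩
    obtain ⟨n, hn⟩ := IsPGroup.iff_card.mp (isPGroup_congruenceSubgroup hR)
    rw [← Nat.card_eq_fintype_card, hn]
    intro h
    have := (Nat.prime_dvd_prime_iff_eq Nat.prime_three Nat.prime_two).mp
      (Nat.prime_three.dvd_of_dvd_pow h)
    omega

/-! ### Exact hitting sets: none globally, many locally -/

section HittingSets

variable {G : Type} [Group G] {ρ : Fin 3 → G}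

/-- Exactly one of the points `g * ρ 0`, `g * ρ 1`, `g * ρ 2` of the line `g` belongs to `I`. -/
def ExactOn (ρ : Fin 3 → G) (I : G → Bool) (g : G) : Prop :=
  ∃! i, I (g * ρ i) = true

/-- Double counting of incidences: there is one for each line, and each point of the hitting set
lies on three lines (one for each index), so the order of `G` would be a multiple of 3. -/
theorem not_forall_exactOn [Fintype G] (h3 : ¬ 3 ∣ Fintype.card G) (I : G → Bool) :
    ¬ ∀ g, ExactOn ρ I g := by
  intro h
  apply h3
  have h1 : ∀ g, ∑ i, (if I (g * ρ i) = true then 1 else 0) = 1 := by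
    intro g
    obtain ⟨i, hi, hu⟩ := h g
    rw [Finset.sum_eq_single i]
    · simpa using hi
    · intro j _ hj
      rw [if_neg]
      exact fun hI => hj (hu j hI)
    · simp
  have h2 : ∀ i, ∑ g, (if I (g * ρ i) = true then 1 else 0) =
      ∑ g, (if I g = true then 1 else 0) := fun i =>
    Fintype.sum_equiv (Equiv.mulRight (ρ i)) _ _ fun g => rfl
  have h4 : Fintype.card G = ∑ g : G, ∑ i, (if I (g * ρ i) = true then 1 else 0) := by
    simp [h1]
  rw [h4, Finset.sum_comm]
  simp only [h2]
  simp

theorem NoShortRelation.injective {m : ℕ} (h : NoShortRelation ρ m) (hm : 2 ≤ m)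
    (hρ : ∀ i, ρ i * ρ i = 1) : Function.Injective ρ := by
  intro i j hij
  by_contra hne
  refine h [i, j] (by simpa using hne) (by simp) (by simpa using hm) ?_
  simp [hij, hρ]

/-- In a small set of lines there is one that has at most one point in common with the others. -/
theorem exists_leaf {m : ℕ} (h : NoShortRelation ρ (2 * m)) (F : Finset G) (hF : F.Nonempty)
    (hc : F.card ≤ m) :
    ∃ g ∈ F, ∃ b, ∀ a ≠ b, ∀ b' ≠ a, g * ρ a * ρ b' ∉ F := by
  by_contra! hcon
  have hstep : ∀ s : F × Fin 3, ∃ a b', a ≠ s.2 ∧ b' ≠ a ∧ (s.1 : G) * ρ a * ρ b' ∈ F := by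
    rintro ⟨⟨g, hg⟩, b⟩
    obtain ⟨a, ha, b', hb', hmem⟩ := hcon g hg b
    exact ⟨a, b', ha, hb', hmem⟩
  choose A B hA hB hmem using hstep
  -- A state is a line together with the index of the point through which it was entered. Without a
  -- leaf, the walk can always leave through a different point `g * ρ a` to another line `g * ρ a *
  -- ρ b'` of `F`, spelling a word without immediate repetitions.
  let next : F × Fin 3 → F × Fin 3 := fun s => (⟨_, hmem s⟩, B s)
  let W : ℕ → F × Fin 3 → List (Fin 3) := fun n => Nat.rec (fun _ => [])
    (fun _ w s => A s :: B s :: w (next s)) n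
  have hW : ∀ n s, W (n + 1) s = A s :: B s :: W n (next s) := fun n s => rfl
  have hlen : ∀ n s, (W n s).length = 2 * n := by
    intro n
    induction n with
    | zero => intro s; rfl
    | succ n ih => intro s; rw [hW, List.length_cons, List.length_cons, ih]; ring
  have hchain : ∀ n s, (s.2 :: W n s).IsChain (· ≠ ·) := by
    intro n
    induction n with
    | zero => intro s; exact List.isChain_singleton _
    | succ n ih =>
      intro s
      rw [hW, List.isChain_cons_cons, List.isChain_cons_cons]
      exact ⟨(hA s).symm, (hB s).symm, ih (next s)⟩
  have hprod : ∀ n s, (((next^[n] s).1 : F) : G) = s.1 * ((W n s).map ρ).prod := by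
    intro n
    induction n with
    | zero => intro s; simp [W]
    | succ n ih =>
      intro s
      rw [Function.iterate_succ_apply, ih, hW]
      simp [next, mul_assoc]
  obtain ⟨g, hg⟩ := hF
  let s₀ : F × Fin 3 := (⟨g, hg⟩, 0)
  -- Some line recurs within `F.card` steps of two letters each, which gives a relation of length at
  -- most `2 * m`.
  obtain ⟨i, j, hij, heq⟩ : ∃ i j : Fin (F.card + 1), i < j ∧
      (next^[(i : ℕ)] s₀).1 = (next^[(j : ℕ)] s₀).1 := by
    obtain ⟨i, j, hne, heq⟩ := Fintype.exists_ne_map_eq_of_card_lt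
      (fun i : Fin (F.card + 1) => (next^[(i : ℕ)] s₀).1) (by simp)
    rcases lt_or_gt_of_ne hne with h | h
    · exact ⟨i, j, h, heq⟩
    · exact ⟨j, i, h, heq.symm⟩
  obtain ⟨n, hn⟩ := Nat.exists_eq_add_of_lt (Fin.lt_def.mp hij)
  have hn' : (j : ℕ) = (n + 1) + i := by omega
  rw [hn', Function.iterate_add_apply] at heq
  have h1 := hprod (n + 1) (next^[(i : ℕ)] s₀)
  rw [← heq] at h1
  refine h (W (n + 1) (next^[(i : ℕ)] s₀)) (hchain (n + 1) (next^[(i : ℕ)] s₀)).tail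
    (by simp [hW]) ?_ (by simpa using h1)
  rw [hlen (n + 1)]
  have := j.2
  omega

/-- A small set of lines has an exact hitting set with prescribed values at two points, unless
both points are to be hit and they lie on one of the lines. -/
theorem exists_exactOn {m : ℕ} (h : NoShortRelation ρ (2 * m)) (hρ : ∀ i, ρ i * ρ i = 1)
    (F : Finset G) (hc : F.card ≤ m) (u v : G) (huv : u ≠ v) (c d : Bool)
    (hcd : c = true → d = true → ∀ g ∈ F, ∀ i j, g * ρ i = u → g * ρ j ≠ v) :
    ∃ I : G → Bool, (∀ g ∈ F, ExactOn ρ I g) ∧ I u = c ∧ I v = d := by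
  classical
  induction hk : F.card generalizing F u v c d with
  | zero =>
    rw [Finset.card_eq_zero] at hk
    subst hk
    exact ⟨Function.update (fun _ => d) u c, by simp, by simp, by simp [huv.symm]⟩
  | succ k ih =>
    have hne : F.Nonempty := Finset.card_pos.mp (by omega)
    obtain ⟨g, hg, b, hb⟩ := exists_leaf h F hne hc
    have hinj : Function.Injective ρ := h.injective (by omega) hρ
    obtain ⟨a₁, a₂, h1, h2, h12, hall⟩ : ∃ a₁ a₂ : Fin 3, a₁ ≠ b ∧ a₂ ≠ b ∧ a₁ ≠ a₂ ∧
        ∀ i, i = b ∨ i = a₁ ∨ i = a₂ := by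
      clear hb
      revert b; decide
    have hpt : ∀ i j, i ≠ j → g * ρ i ≠ g * ρ j := fun i j hij he =>
      hij (hinj (mul_left_cancel he))
    -- The two points of the leaf `g` other than `g * ρ b` lie on no other line of `F`, so their
    -- values can be changed freely.
    have hpriv : ∀ a ≠ b, ∀ g' ∈ F.erase g, ∀ i, g' * ρ i ≠ g * ρ a := by
      intro a ha g' hg' i he
      rw [Finset.mem_erase] at hg'
      have he' : g * ρ a * ρ i = g' := by rw [← he, mul_assoc, hρ, mul_one]
      by_cases hia : i = a
      · subst hia
        exact hg'.1 (mul_right_cancel he)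
      · exact hb a ha i hia (he' ▸ hg'.2)
    -- extension of a hitting set of the other lines
    have hext : ∀ (I : G → Bool) (x y : Bool), (∀ g' ∈ F.erase g, ExactOn ρ I g') →
        ((I (g * ρ b) = true ∧ x = false ∧ y = false) ∨
          (I (g * ρ b) = false ∧ x = true ∧ y = false) ∨
          (I (g * ρ b) = false ∧ x = false ∧ y = true)) →
        ∃ J : G → Bool, (∀ g' ∈ F, ExactOn ρ J g') ∧ J (g * ρ a₁) = x ∧ J (g * ρ a₂) = y ∧
          ∀ w, w ≠ g * ρ a₁ → w ≠ g * ρ a₂ → J w = I w := by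
      intro I x y hI hxy
      let J := Function.update (Function.update I (g * ρ a₂) y) (g * ρ a₁) x
      have hJ1 : J (g * ρ a₁) = x := by simp [J]
      have hJ2 : J (g * ρ a₂) = y := by simp [J, Function.update_of_ne (hpt _ _ h12.symm)]
      have hJ : ∀ w, w ≠ g * ρ a₁ → w ≠ g * ρ a₂ → J w = I w := by
        intro w hw1 hw2
        simp [J, Function.update_of_ne hw1, Function.update_of_ne hw2]
      have hJb := hJ _ (hpt _ _ h1.symm) (hpt _ _ h2.symm)
      refine ⟨J, ?_, hJ1, hJ2, hJ⟩
      intro g' hg'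
      by_cases hgg : g' = g
      · subst hgg
        have hval : ∀ i, J (g' * ρ i) = true →
            (i = b ∧ I (g' * ρ b) = true) ∨ (i = a₁ ∧ x = true) ∨ (i = a₂ ∧ y = true) := by
          intro i hi
          rcases hall i with e | e | e <;> rw [e] at hi
          · exact Or.inl ⟨e, hJb.symm.trans hi⟩
          · exact Or.inr (Or.inl ⟨e, hJ1.symm.trans hi⟩)
          · exact Or.inr (Or.inr ⟨e, hJ2.symm.trans hi⟩)
        rcases hxy with ⟨e1, e2, e3⟩ | ⟨e1, e2, e3⟩ | ⟨e1, e2, e3⟩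
        · refine ⟨b, hJb.trans e1, fun i hi => ?_⟩
          simpa [e2, e3, e1] using hval i hi
        · refine ⟨a₁, hJ1.trans e2, fun i hi => ?_⟩
          simpa [e2, e3, e1] using hval i hi
        · refine ⟨a₂, hJ2.trans e3, fun i hi => ?_⟩
          simpa [e2, e3, e1] using hval i hi
      · have hm' : g' ∈ F.erase g := Finset.mem_erase.mpr ⟨hgg, hg'⟩
        have he : ∀ i, J (g' * ρ i) = I (g' * ρ i) := fun i =>
          hJ _ (hpriv a₁ h1 g' hm' i) (hpriv a₂ h2 g' hm' i)
        simpa only [ExactOn, he] using hI g' hm'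
    have hcard : (F.erase g).card = k := by rw [Finset.card_erase_of_mem hg, hk]; rfl
    have hih := ih (F.erase g) (by omega)
    -- The case where a prescribed point is the private point `g * ρ a`. The induction hypothesis
    -- fixes the value at the shared point `g * ρ b` (and at `w`, if `w` is off the line), and the
    -- leaf is then completed to exactly one hit.
    have hkey : ∀ (a a' : Fin 3) (w : G) (c d : Bool), a ≠ b → a' ≠ b → a ≠ a' →
        w ≠ g * ρ a → (c = true → d = true → ∀ j, g * ρ j ≠ w) →
        (∀ (I : G → Bool) (x y : Bool), (∀ g' ∈ F.erase g, ExactOn ρ I g') →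
          ((I (g * ρ b) = true ∧ x = false ∧ y = false) ∨
          (I (g * ρ b) = false ∧ x = true ∧ y = false) ∨
          (I (g * ρ b) = false ∧ x = false ∧ y = true)) →
          ∃ J : G → Bool, (∀ g' ∈ F, ExactOn ρ J g') ∧ J (g * ρ a) = x ∧ J (g * ρ a') = y ∧
            ∀ w, w ≠ g * ρ a → w ≠ g * ρ a' → J w = I w) →
        ∃ J : G → Bool, (∀ g' ∈ F, ExactOn ρ J g') ∧ J (g * ρ a) = c ∧ J w = d := by
      intro a a' w c d ha ha' haa hw hcd hext
      by_cases hw' : w = g * ρ a'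
      · have hcd' : c = true → d = true → False := fun e1 e2 => hcd e1 e2 a' hw'.symm
        obtain ⟨I, hI, hIb, -⟩ := hih (g * ρ b) (g * ρ a) (hpt _ _ ha.symm) (!(c || d)) false
          (by simp) hcard
        obtain ⟨J, hJ, hJ1, hJ2, -⟩ := hext I c d hI (by
          cases c <;> cases d <;> first | exact (hcd' rfl rfl).elim | simpa using hIb)
        exact ⟨J, hJ, hJ1, hw' ▸ hJ2⟩
      · by_cases hwb : w = g * ρ b
        · have hcd' : c = true → d = true → False := fun e1 e2 => hcd e1 e2 b hwb.symm
          obtain ⟨I, hI, hIb, -⟩ := hih (g * ρ b) (g * ρ a) (hpt _ _ ha.symm) d false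
            (by simp) hcard
          obtain ⟨J, hJ, hJ1, -, hJ3⟩ := hext I c (!(c || d)) hI
            (by cases c <;> cases d <;> first | exact (hcd' rfl rfl).elim | simpa using hIb)
          exact ⟨J, hJ, hJ1, by rw [hJ3 w hw hw', hwb, hIb]⟩
        · obtain ⟨I, hI, hIw, hIb⟩ := hih w (g * ρ b) hwb d false (by simp) hcard
          obtain ⟨J, hJ, hJ1, -, hJ3⟩ := hext I c (!c) hI (by cases c <;> simpa using hIb)
          exact ⟨J, hJ, hJ1, by rw [hJ3 w hw hw', hIw]⟩
    have hext' : ∀ (I : G → Bool) (x y : Bool), (∀ g' ∈ F.erase g, ExactOn ρ I g') →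
        ((I (g * ρ b) = true ∧ x = false ∧ y = false) ∨
          (I (g * ρ b) = false ∧ x = true ∧ y = false) ∨
          (I (g * ρ b) = false ∧ x = false ∧ y = true)) →
        ∃ J : G → Bool, (∀ g' ∈ F, ExactOn ρ J g') ∧ J (g * ρ a₂) = x ∧ J (g * ρ a₁) = y ∧
          ∀ w, w ≠ g * ρ a₂ → w ≠ g * ρ a₁ → J w = I w := by
      intro I x y hI hxy
      obtain ⟨J, e1, e2, e3, e4⟩ := hext I y x hI (by tauto)
      exact ⟨J, e1, e3, e2, fun w f1 f2 => e4 w f2 f1⟩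
    have hcd' : d = true → c = true → ∀ i j, g * ρ i = v → g * ρ j ≠ u :=
      fun e1 e2 i j hi hj => hcd e2 e1 g hg j i hj hi
    by_cases hu1 : u = g * ρ a₁
    · subst hu1
      exact hkey a₁ a₂ v c d h1 h2 h12 huv.symm
        (fun e1 e2 j => hcd e1 e2 g hg a₁ j rfl) hext
    by_cases hu2 : u = g * ρ a₂
    · subst hu2
      exact hkey a₂ a₁ v c d h2 h1 h12.symm huv.symm
        (fun e1 e2 j => hcd e1 e2 g hg a₂ j rfl) hext'
    by_cases hv1 : v = g * ρ a₁
    · subst hv1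
      obtain ⟨J, e1, e2, e3⟩ := hkey a₁ a₂ u d c h1 h2 h12 huv
        (fun e1 e2 j => hcd' e1 e2 a₁ j rfl) hext
      exact ⟨J, e1, e3, e2⟩
    by_cases hv2 : v = g * ρ a₂
    · subst hv2
      obtain ⟨J, e1, e2, e3⟩ := hkey a₂ a₁ u d c h2 h1 h12.symm huv
        (fun e1 e2 j => hcd' e1 e2 a₂ j rfl) hext'
      exact ⟨J, e1, e3, e2⟩
    obtain ⟨I, hI, hIu, hIv⟩ := hih u v huv c d
      (fun e1 e2 g' hg' => hcd e1 e2 g' (Finset.mem_of_mem_erase hg')) hcard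
    -- Neither prescribed point is private: one private point is hit precisely when the shared point
    -- is not.
    obtain ⟨J, hJ, -, -, hJ3⟩ := hext I (!(I (g * ρ b))) false hI
      (by cases I (g * ρ b) <;> simp)
    exact ⟨J, hJ, by rw [hJ3 u hu1 hu2, hIu], by rw [hJ3 v hv1 hv2, hIv]⟩

theorem exists_exactOn_one {m : ℕ} (h : NoShortRelation ρ (2 * m)) (hm : 1 ≤ m)
    (hρ : ∀ i, ρ i * ρ i = 1) (F : Finset G) (hc : F.card ≤ m) (u : G) (c : Bool) :
    ∃ I : G → Bool, (∀ g ∈ F, ExactOn ρ I g) ∧ I u = c := by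
  have hu : u ≠ u * ρ 0 := by
    intro he
    exact h [0] (by simp) (by simp) (by simp; omega) (by simpa using he.symm)
  obtain ⟨I, h1, h2, -⟩ := exists_exactOn h hρ F hc u _ hu c false (by simp)
  exact ⟨I, h1, h2⟩

end HittingSets

/-! ### Identities, the flat algebra and the algebra of a hypergraph -/

namespace SAlg

/-- Models of an identity are closed under the variety operators. -/
theorem isVariety_satisfies (e : Term × Term) : IsVariety {A | A.Satisfies e} := by
  have hhom : ∀ (A B : SAlg) (f : A.carrier → B.carrier), IsHom A B f →
      ∀ (v : ℕ → A.carrier) (t : Term), B.eval (f ∘ v) t = f (A.eval v t) := by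
    intro A B f hf v t
    induction t with
    | var n => rfl
    | add s t hs ht => rw [eval, eval, hs, ht, hf.map_add]
    | mul s t hs ht => rw [eval, eval, hs, ht, hf.map_mul]
  refine ⟨?_, ?_, ?_⟩
  · intro A hA B f hf hs v
    obtain ⟨g, hg⟩ := hs.hasRightInverse
    have hv : v = f ∘ (g ∘ v) := by ext n; simp [hg (v n)]
    rw [hv, hhom A B f hf, hhom A B f hf, hA]
  · intro A hA B f hf hi v
    apply hi
    rw [← hhom B A f hf, ← hhom B A f hf, hA]
  · intro ι A hA v
    funext i
    have hp : IsHom (SAlg.prod A) (A i) (fun x => x i) := ⟨fun _ _ => rfl, fun _ _ => rfl⟩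
    have h1 := hhom _ _ _ hp v e.1
    have h2 := hhom _ _ _ hp v e.2
    rw [← h1, ← h2]
    exact hA i _

theorem Satisfies.of_mem_varietyGen {A B : SAlg} {e : Term × Term} (h : A.Satisfies e)
    (hB : B ∈ varietyGen A) : B.Satisfies e :=
  hB _ ⟨isVariety_satisfies e, h⟩

/-- The number of nodes of a term. -/
def Term.size : Term → ℕ
  | var _ => 1
  | add s t => s.size + t.size + 1
  | mul s t => s.size + t.size + 1

/-- Flat addition on `∞, a, 1`, where `∞ = none`, `a = some true`, `1 = some false`. -/
def flatAdd : Option Bool → Option Bool → Option Bool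
  | some c, some d => if c = d then some c else none
  | _, _ => none

/-- Multiplication on `∞, a, 1`, where `∞ = none`, `a = some true`, `1 = some false`. -/
def flatMul : Option Bool → Option Bool → Option Bool
  | some c, some d => if c && d then none else some (c || d)
  | _, _ => none

/-- The three-element algebra on `∞, a, 1`. -/
def flatThree : SAlg := ⟨Option Bool, flatAdd, flatMul, ⟨none⟩⟩

/-- Evaluation in the three-element algebra. -/
def flatEval (v : ℕ → Option Bool) (t : Term) : Option Bool := flatThree.eval v t

theorem flatEval_var (v : ℕ → Option Bool) (n : ℕ) : flatEval v (.var n) = v n := rfl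

theorem flatEval_add (v : ℕ → Option Bool) (s t : Term) :
    flatEval v (s.add t) = flatAdd (flatEval v s) (flatEval v t) := rfl

theorem flatEval_mul (v : ℕ → Option Bool) (s t : Term) :
    flatEval v (s.mul t) = flatMul (flatEval v s) (flatEval v t) := rfl

/-- The elements of the algebra of a hypergraph. -/
inductive HElt (G : Type) : Type
  | infty
  | a
  | x (u : G)
  | y (u : G)

section HypergraphAlgebra

variable {G : Type} [Group G] (ρ : Fin 3 → G)

/-- The points `u`, `v`, `w` are the three points of a line. -/
def IsLine (u v w : G) : Prop :=
  ∃ g i j k, i ≠ j ∧ i ≠ k ∧ j ≠ k ∧ u = g * ρ i ∧ v = g * ρ j ∧ w = g * ρ k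

open Classical in
/-- Flat addition. -/
noncomputable def hypAdd (c d : HElt G) : HElt G := if c = d then c else HElt.infty

open Classical in
/-- Multiplication in the algebra of a hypergraph: `x u * y u = a`, and `x u * x v = y w` if
`u`, `v`, `w` are the points of a line. -/
noncomputable def hypMul : HElt G → HElt G → HElt G
  | HElt.x u, HElt.x v => if h : ∃ w, IsLine ρ u v w then HElt.y h.choose else HElt.infty
  | HElt.x u, HElt.y v => if u = v then HElt.a else HElt.infty
  | HElt.y u, HElt.x v => if u = v then HElt.a else HElt.infty
  | _, _ => HElt.infty

/-- The algebra of the hypergraph with lines `{g * ρ 0, g * ρ 1, g * ρ 2}`. -/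
noncomputable def hypAlg : SAlg := ⟨HElt G, hypAdd, hypMul ρ, ⟨HElt.infty⟩⟩

/-- Evaluation in the algebra of a hypergraph. -/
noncomputable def hypEval (v : ℕ → HElt G) (t : Term) : HElt G := (hypAlg ρ).eval v t

theorem hypEval_var (v : ℕ → HElt G) (n : ℕ) : hypEval ρ v (.var n) = v n := rfl

theorem hypEval_add (v : ℕ → HElt G) (s t : Term) :
    hypEval ρ v (s.add t) = hypAdd (hypEval ρ v s) (hypEval ρ v t) := rfl

theorem hypEval_mul (v : ℕ → HElt G) (s t : Term) :
    hypEval ρ v (s.mul t) = hypMul ρ (hypEval ρ v s) (hypEval ρ v t) := rfl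

/-- The map to the three-element algebra given by a set of points. -/
def HElt.toFlat (I : G → Bool) : HElt G → Option Bool
  | infty => none
  | a => some true
  | x u => some (I u)
  | y u => some (!I u)

variable {ρ}

omit [Group G] in
theorem HElt.toFlat_ne_none (I : G → Bool) {c : HElt G} (hc : c ≠ infty) : c.toFlat I ≠ none := by
  cases c <;> simp_all [HElt.toFlat]

/-- On a line with exactly one hit, the product of the images of `x u` and `x v` is `a` when `u` or
`v` is hit and `1` when the third point `w` is, which is the image of `y w`. The products equal to
`a` need no line, so any `g` serves there. -/
theorem toFlat_mul (c d : HElt G) (h : hypMul ρ c d ≠ HElt.infty) :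
    ∃ g, ∀ I, ExactOn ρ I g →
      (hypMul ρ c d).toFlat I = flatMul (c.toFlat I) (d.toFlat I) := by
  cases c with
  | infty => simp [hypMul] at h
  | a => simp [hypMul] at h
  | x u =>
    cases d with
    | infty => simp [hypMul] at h
    | a => simp [hypMul] at h
    | x v =>
      by_cases hw : ∃ w, IsLine ρ u v w
      · obtain ⟨g, i, j, k, hij, hik, hjk, hu, hv, hk⟩ := hw.choose_spec
        refine ⟨g, ?_⟩
        rintro I ⟨l, hl, hl'⟩
        simp only [hypMul, dif_pos hw]
        simp only [HElt.toFlat, hk]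
        rw [hu, hv]
        have e : ∀ n, I (g * ρ n) = decide (n = l) := by
          intro n
          by_cases hn : n = l
          · subst hn; simpa using hl
          · simpa [hn] using fun h => hn (hl' n h)
        rw [e, e, e]
        clear * - hij hik hjk
        revert i j k l
        decide
      · simp [hypMul, hw] at h
    | y v =>
      by_cases huv : u = v
      · subst huv
        refine ⟨1, fun I _ => ?_⟩
        simp only [hypMul, if_true, HElt.toFlat, flatMul]
        cases I u <;> rfl
      · simp [hypMul, huv] at h
  | y u =>
    cases d with
    | infty => simp [hypMul] at h
    | a => simp [hypMul] at h
    | y v => simp [hypMul] at h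
    | x v =>
      by_cases huv : u = v
      · subst huv
        refine ⟨1, fun I _ => ?_⟩
        simp only [hypMul, if_true, HElt.toFlat, flatMul]
        cases I u <;> rfl
      · simp [hypMul, huv] at h

variable {m : ℕ} (h : NoShortRelation ρ (2 * m)) (hm : 1 ≤ m) (hρ : ∀ i, ρ i * ρ i = 1)
  (F : Finset G) (hF : F.card ≤ m)

include h hm hρ hF

/-- Distinct elements are separated by hitting sets of a given small set of lines. -/
theorem exists_toFlat_ne {c d : HElt G} (hc : c ≠ HElt.infty) (hd : d ≠ HElt.infty)
    (hcd : c ≠ d) : ∃ I, (∀ g ∈ F, ExactOn ρ I g) ∧ c.toFlat I ≠ d.toFlat I := by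
  have h1 := exists_exactOn_one h hm hρ F hF
  have h2 := fun u v (huv : u ≠ v) c =>
    exists_exactOn h hρ F hF u v huv c false (by simp)
  cases c with
  | infty => exact absurd rfl hc
  | a =>
    cases d with
    | infty => exact absurd rfl hd
    | a => exact absurd rfl hcd
    | x v => obtain ⟨I, hI, e⟩ := h1 v false; exact ⟨I, hI, by simp [HElt.toFlat, e]⟩
    | y v => obtain ⟨I, hI, e⟩ := h1 v true; exact ⟨I, hI, by simp [HElt.toFlat, e]⟩
  | x u =>
    cases d with
    | infty => exact absurd rfl hd
    | a => obtain ⟨I, hI, e⟩ := h1 u false; exact ⟨I, hI, by simp [HElt.toFlat, e]⟩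
    | x v =>
      obtain ⟨I, hI, e, e'⟩ := h2 u v (by rintro rfl; exact hcd rfl) true
      exact ⟨I, hI, by simp [HElt.toFlat, e, e']⟩
    | y v =>
      by_cases huv : u = v
      · subst huv
        obtain ⟨I, hI, e⟩ := h1 u false; exact ⟨I, hI, by simp [HElt.toFlat, e]⟩
      · obtain ⟨I, hI, e, e'⟩ := h2 u v huv false
        exact ⟨I, hI, by simp [HElt.toFlat, e, e']⟩
  | y u =>
    cases d with
    | infty => exact absurd rfl hd
    | a => obtain ⟨I, hI, e⟩ := h1 u true; exact ⟨I, hI, by simp [HElt.toFlat, e]⟩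
    | x v =>
      by_cases huv : u = v
      · subst huv
        obtain ⟨I, hI, e⟩ := h1 u false; exact ⟨I, hI, by simp [HElt.toFlat, e]⟩
      · obtain ⟨I, hI, e, e'⟩ := h2 u v huv false
        exact ⟨I, hI, by simp [HElt.toFlat, e, e']⟩
    | y v =>
      obtain ⟨I, hI, e, e'⟩ := h2 u v (by rintro rfl; exact hcd rfl) true
      exact ⟨I, hI, by simp [HElt.toFlat, e, e']⟩

/-- A product equal to `∞` is detected by hitting sets of a given small set of lines. -/
theorem exists_toFlat_eq_true {c d : HElt G} (hc : c ≠ HElt.infty) (hd : d ≠ HElt.infty)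
    (hcd : hypMul ρ c d = HElt.infty) :
    ∃ I, (∀ g ∈ F, ExactOn ρ I g) ∧ c.toFlat I = some true ∧ d.toFlat I = some true := by
  have h1 := exists_exactOn_one h hm hρ F hF
  have h2 := fun u v (huv : u ≠ v) c =>
    exists_exactOn h hρ F hF u v huv c false (by simp)
  cases c with
  | infty => exact absurd rfl hc
  | a =>
    cases d with
    | infty => exact absurd rfl hd
    | a => obtain ⟨I, hI, e⟩ := h1 1 false; exact ⟨I, hI, rfl, rfl⟩
    | x v => obtain ⟨I, hI, e⟩ := h1 v true; exact ⟨I, hI, by simp [HElt.toFlat, e]⟩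
    | y v => obtain ⟨I, hI, e⟩ := h1 v false; exact ⟨I, hI, by simp [HElt.toFlat, e]⟩
  | x u =>
    cases d with
    | infty => exact absurd rfl hd
    | a => obtain ⟨I, hI, e⟩ := h1 u true; exact ⟨I, hI, by simp [HElt.toFlat, e]⟩
    | x v =>
      by_cases huv : u = v
      · subst huv
        obtain ⟨I, hI, e⟩ := h1 u true; exact ⟨I, hI, by simp [HElt.toFlat, e]⟩
      · have hw : ¬ ∃ w, IsLine ρ u v w := by
          intro hw
          simp [hypMul, hw] at hcd
        -- Both points can be hit because they are not collinear; this is the only use of two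
        -- prescribed hits.
        obtain ⟨I, hI, e, e'⟩ := exists_exactOn h hρ F hF u v huv true true (by
          intro _ _ g _ i j hi hj
          apply hw
          have hij : i ≠ j := by rintro rfl; exact huv (hi.symm.trans hj)
          obtain ⟨k, hik, hjk⟩ : ∃ k, i ≠ k ∧ j ≠ k := by
            clear * -; revert i j; decide
          exact ⟨_, g, i, j, k, hij, hik, hjk, hi.symm, hj.symm, rfl⟩)
        exact ⟨I, hI, by simp [HElt.toFlat, e, e']⟩
    | y v =>
      have huv : u ≠ v := by rintro rfl; simp [hypMul] at hcd
      obtain ⟨I, hI, e, e'⟩ := h2 u v huv true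
      exact ⟨I, hI, by simp [HElt.toFlat, e, e']⟩
  | y u =>
    cases d with
    | infty => exact absurd rfl hd
    | a => obtain ⟨I, hI, e⟩ := h1 u false; exact ⟨I, hI, by simp [HElt.toFlat, e]⟩
    | x v =>
      have huv : v ≠ u := by rintro rfl; simp [hypMul] at hcd
      obtain ⟨I, hI, e, e'⟩ := h2 v u huv true
      exact ⟨I, hI, by simp [HElt.toFlat, e, e']⟩
    | y v =>
      by_cases huv : u = v
      · subst huv
        obtain ⟨I, hI, e⟩ := h1 u false; exact ⟨I, hI, by simp [HElt.toFlat, e]⟩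
      · obtain ⟨I, hI, e, e'⟩ := h2 u v huv false
        exact ⟨I, hI, by simp [HElt.toFlat, e, e']⟩

omit hF F

/-- `F` collects the lines used by the nonzero products in `t`. A value other than `∞` is respected
by every `I` exact on `F`, whereas `∞` is detected only by a suitable `I`. The supersets `F'` let
this `I` be exact also on the lines of a sibling subterm or of the other side of an identity. -/
theorem exists_lines_eval (v : ℕ → HElt G) (t : Term) :
    ∃ F : Finset G, F.card ≤ t.size ∧
      (hypEval ρ v t ≠ HElt.infty → ∀ I, (∀ g ∈ F, ExactOn ρ I g) →
        flatEval (fun n => (v n).toFlat I) t = HElt.toFlat I (hypEval ρ v t)) ∧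
      (hypEval ρ v t = HElt.infty → ∀ F', F ⊆ F' → F'.card ≤ m →
        ∃ I, (∀ g ∈ F', ExactOn ρ I g) ∧
          flatEval (fun n => (v n).toFlat I) t = none) := by
  classical
  have hnone_add : ∀ o : Option Bool, flatAdd o none = none := by
    intro o; cases o <;> rfl
  have hnone_mul : ∀ o : Option Bool, flatMul o none = none := by
    intro o; cases o <;> rfl
  have hadd : ∀ c d : HElt G, hypAdd c d = if c = d then c else HElt.infty :=
    fun c d => rfl
  induction t with
  | var n =>
    refine ⟨∅, by simp, fun _ I _ => rfl, fun ht F' _ hF' => ?_⟩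
    obtain ⟨I, hI, -⟩ := exists_exactOn_one h hm hρ F' hF' 1 false
    refine ⟨I, hI, ?_⟩
    rw [hypEval_var] at ht
    rw [flatEval_var, ht]; rfl
  | add s t hs ht =>
    obtain ⟨F₁, hc₁, hs₁, hs₂⟩ := hs
    obtain ⟨F₂, hc₂, ht₁, ht₂⟩ := ht
    refine ⟨F₁ ∪ F₂, ?_, ?_, ?_⟩
    · have := Finset.card_union_le F₁ F₂
      rw [Term.size]; omega
    · intro hne I hI
      rw [hypEval_add, hadd] at hne
      have heq : hypEval ρ v s = hypEval ρ v t := by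
        by_contra hcon; simp [hcon] at hne
      rw [if_pos heq] at hne
      rw [flatEval_add, hypEval_add, hadd, if_pos heq,
        hs₁ hne I (fun g hg => hI g (Finset.mem_union_left _ hg)),
        ht₁ (heq ▸ hne) I (fun g hg => hI g (Finset.mem_union_right _ hg)), ← heq]
      cases hx : HElt.toFlat I (hypEval ρ v s) <;> simp [flatAdd]
    · intro hinf F' hsub hF'
      have hsub₁ := Finset.subset_union_left.trans hsub
      have hsub₂ := Finset.subset_union_right.trans hsub
      by_cases e₁ : hypEval ρ v s = HElt.infty
      · obtain ⟨I, hI, e⟩ := hs₂ e₁ F' hsub₁ hF'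
        exact ⟨I, hI, by rw [flatEval_add, e]; rfl⟩
      by_cases e₂ : hypEval ρ v t = HElt.infty
      · obtain ⟨I, hI, e⟩ := ht₂ e₂ F' hsub₂ hF'
        exact ⟨I, hI, by rw [flatEval_add, e, hnone_add]⟩
      have hne : hypEval ρ v s ≠ hypEval ρ v t := by
        intro heq
        rw [hypEval_add, hadd, if_pos heq] at hinf
        exact e₁ hinf
      obtain ⟨I, hI, e⟩ := exists_toFlat_ne h hm hρ F' hF' e₁ e₂ hne
      refine ⟨I, hI, ?_⟩
      rw [flatEval_add, hs₁ e₁ I (fun g hg => hI g (hsub₁ hg)),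
        ht₁ e₂ I (fun g hg => hI g (hsub₂ hg))]
      cases hx : HElt.toFlat I (hypEval ρ v s) <;>
        cases hy : HElt.toFlat I (hypEval ρ v t) <;> simp_all [flatAdd]
  | mul s t hs ht =>
    obtain ⟨F₁, hc₁, hs₁, hs₂⟩ := hs
    obtain ⟨F₂, hc₂, ht₁, ht₂⟩ := ht
    have hg : ∃ g, hypEval ρ v (s.mul t) ≠ HElt.infty → ∀ I, ExactOn ρ I g →
        HElt.toFlat I (hypEval ρ v (s.mul t)) =
          flatMul (HElt.toFlat I (hypEval ρ v s))
            (HElt.toFlat I (hypEval ρ v t)) := by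
      by_cases hne : hypEval ρ v (s.mul t) ≠ HElt.infty
      · obtain ⟨g, hg⟩ := toFlat_mul _ _ hne
        exact ⟨g, fun _ => hg⟩
      · exact ⟨1, fun h => absurd h hne⟩
    obtain ⟨g₀, hg₀⟩ := hg
    refine ⟨insert g₀ (F₁ ∪ F₂), ?_, ?_, ?_⟩
    · have := Finset.card_union_le F₁ F₂
      have := Finset.card_insert_le g₀ (F₁ ∪ F₂)
      rw [Term.size]; omega
    · intro hne I hI
      have e₁ : hypEval ρ v s ≠ HElt.infty := by
        intro e; apply hne; rw [hypEval_mul, e]; rfl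
      have e₂ : hypEval ρ v t ≠ HElt.infty := by
        intro e; apply hne; rw [hypEval_mul, e]
        cases hypEval ρ v s <;> rfl
      rw [hg₀ hne I (hI g₀ (by simp)), flatEval_mul,
        hs₁ e₁ I (fun g hg => hI g (by simp [hg])),
        ht₁ e₂ I (fun g hg => hI g (by simp [hg]))]
    · intro hinf F' hsub hF'
      have hsub₁ : F₁ ⊆ F' := fun g hg => hsub (by simp [hg])
      have hsub₂ : F₂ ⊆ F' := fun g hg => hsub (by simp [hg])
      by_cases e₁ : hypEval ρ v s = HElt.infty
      · obtain ⟨I, hI, e⟩ := hs₂ e₁ F' hsub₁ hF'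
        exact ⟨I, hI, by rw [flatEval_mul, e]; rfl⟩
      by_cases e₂ : hypEval ρ v t = HElt.infty
      · obtain ⟨I, hI, e⟩ := ht₂ e₂ F' hsub₂ hF'
        exact ⟨I, hI, by rw [flatEval_mul, e, hnone_mul]⟩
      obtain ⟨I, hI, e, e'⟩ := exists_toFlat_eq_true h hm hρ F' hF' e₁ e₂ hinf
      refine ⟨I, hI, ?_⟩
      rw [flatEval_mul, hs₁ e₁ I (fun g hg => hI g (hsub₁ hg)),
        ht₁ e₂ I (fun g hg => hI g (hsub₂ hg)), e, e']
      rfl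

/-- The algebra of the hypergraph satisfies the short identities of the three-element algebra. -/
theorem hypAlg_satisfies (e : Term × Term) (he : flatThree.Satisfies e)
    (hsize : e.1.size + e.2.size ≤ m) : (hypAlg ρ).Satisfies e := by
  classical
  intro (v : ℕ → HElt G)
  have he' : ∀ v, flatEval v e.1 = flatEval v e.2 := he
  change hypEval ρ v e.1 = hypEval ρ v e.2
  obtain ⟨F₁, hc₁, hs₁, hs₂⟩ := exists_lines_eval h hm hρ v e.1
  obtain ⟨F₂, hc₂, ht₁, ht₂⟩ := exists_lines_eval h hm hρ v e.2
  have hF : (F₁ ∪ F₂).card ≤ m := by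
    have := Finset.card_union_le F₁ F₂
    omega
  have hsub₁ : ∀ g ∈ F₁, g ∈ F₁ ∪ F₂ := fun g hg => Finset.mem_union_left _ hg
  have hsub₂ : ∀ g ∈ F₂, g ∈ F₁ ∪ F₂ := fun g hg => Finset.mem_union_right _ hg
  by_contra hne
  by_cases e₁ : hypEval ρ v e.1 = HElt.infty
  · have e₂ : hypEval ρ v e.2 ≠ HElt.infty := fun e₂ => hne (e₁.trans e₂.symm)
    obtain ⟨I, hI, hI'⟩ := hs₂ e₁ _ hsub₁ hF
    have := ht₁ e₂ I (fun g hg => hI g (hsub₂ g hg))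
    rw [← he', hI'] at this
    exact HElt.toFlat_ne_none I e₂ this.symm
  by_cases e₂ : hypEval ρ v e.2 = HElt.infty
  · obtain ⟨I, hI, hI'⟩ := ht₂ e₂ _ hsub₂ hF
    have := hs₁ e₁ I (fun g hg => hI g (hsub₁ g hg))
    rw [he', hI'] at this
    exact HElt.toFlat_ne_none I e₁ this.symm
  obtain ⟨I, hI, hI'⟩ := exists_toFlat_ne h hm hρ _ hF e₁ e₂ hne
  apply hI'
  rw [← hs₁ e₁ I (fun g hg => hI g (hsub₁ g hg)), ← ht₁ e₂ I (fun g hg => hI g (hsub₂ g hg)), he']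

end HypergraphAlgebra

/-! ### The long identity fails in the algebra of the hypergraph -/

section LineSum

/-- The sum of the three cyclic rotations of the product of three variables. -/
def cyclicTerm (i j k : ℕ) : Term :=
  (((Term.var i).mul ((Term.var j).mul (Term.var k))).add
    ((Term.var j).mul ((Term.var k).mul (Term.var i)))).add
    ((Term.var k).mul ((Term.var i).mul (Term.var j)))

variable {G : Type} [Group G] (ρ : Fin 3 → G) (n : G → ℕ)

/-- The sum of the cyclic terms of the lines `1` and `g ∈ l`. -/
def lineSum (l : List G) : Term :=
  l.foldr (fun g t => (cyclicTerm (n (g * ρ 0)) (n (g * ρ 1)) (n (g * ρ 2))).add t)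
    -- The signature has no zero, so the fold starts from the line `1`; repeating that line is
    -- harmless, addition being idempotent.
    (cyclicTerm (n (1 * ρ 0)) (n (1 * ρ 1)) (n (1 * ρ 2)))

theorem lineSum_cons (g : G) (l : List G) : lineSum ρ n (g :: l) =
    (cyclicTerm (n (g * ρ 0)) (n (g * ρ 1)) (n (g * ρ 2))).add (lineSum ρ n l) := rfl

variable {ρ n}

/-- Two different lines with two common points would give a relation of length 2 or 4. Hence the
chosen third point in `hypMul` is the expected one. -/
theorem IsLine.unique {m : ℕ} (h : NoShortRelation ρ m) (hm : 4 ≤ m) (hρ : ∀ i, ρ i * ρ i = 1)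
    {u v w w' : G} (hw : IsLine ρ u v w) (hw' : IsLine ρ u v w') : w = w' := by
  obtain ⟨g, i, j, k, hij, hik, hjk, hu, hv, hk⟩ := hw
  obtain ⟨g', i', j', k', hij', hik', hjk', hu', hv', hk'⟩ := hw'
  have hinv : ∀ i, (ρ i)⁻¹ = ρ i := fun i => inv_eq_of_mul_eq_one_left (hρ i)
  have hi : g⁻¹ * g' = ρ i * ρ i' := by
    have := hu.symm.trans hu'
    rw [inv_mul_eq_iff_eq_mul, ← mul_assoc, this, mul_assoc, hρ, mul_one]
  have hj : g⁻¹ * g' = ρ j * ρ j' := by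
    have := hv.symm.trans hv'
    rw [inv_mul_eq_iff_eq_mul, ← mul_assoc, this, mul_assoc, hρ, mul_one]
  have hii : i = i' := by
    by_contra hne
    by_cases hjj : j = j'
    · subst hjj
      refine h [i, i'] (by simpa using hne) (by simp) (by simp; omega) ?_
      simp [← hi, hj, hρ]
    · refine h [i', i, j, j'] ?_ (by simp) (by simpa using hm) ?_
      · simp [Ne.symm hne, hij, hjj]
      · have : ρ i' * ρ i = (ρ i * ρ i')⁻¹ := by rw [mul_inv_rev, hinv, hinv]
        simp only [List.map_cons, List.map_nil, List.prod_cons, List.prod_nil, mul_one]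
        rw [← mul_assoc, this, ← hi, ← hj, inv_mul_cancel]
  subst hii
  have hgg : g = g' := by
    rw [hρ] at hi
    exact (inv_mul_eq_one.mp hi)
  subst hgg
  have hjj : j = j' := h.injective (by omega) hρ (mul_left_cancel (hv.symm.trans hv'))
  subst hjj
  have : k = k' := by clear * - hij hik hjk hik' hjk'; revert i j k k'; decide
  rw [hk, hk', this]

theorem hypEval_lineSum {m : ℕ} (h : NoShortRelation ρ m) (hm : 4 ≤ m)
    (hρ : ∀ i, ρ i * ρ i = 1) (v : ℕ → HElt G) (hv : ∀ g, v (n g) = HElt.x g) (l : List G) :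
    hypEval ρ v (lineSum ρ n l) = HElt.a := by
  have hmul : ∀ g i j k, i ≠ j → i ≠ k → j ≠ k →
      hypMul ρ (HElt.x (g * ρ i)) (hypMul ρ (HElt.x (g * ρ j)) (HElt.x (g * ρ k))) =
        HElt.a := by
    intro g i j k hij hik hjk
    have hl : IsLine ρ (g * ρ j) (g * ρ k) (g * ρ i) :=
      ⟨g, j, k, i, hjk, hij.symm, hik.symm, rfl, rfl, rfl⟩
    have hex : ∃ w, IsLine ρ (g * ρ j) (g * ρ k) w := ⟨_, hl⟩
    have := IsLine.unique h hm hρ hl hex.choose_spec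
    simp only [hypMul, dif_pos hex, ← this, if_true]
  have haa : hypAdd HElt.a HElt.a = (HElt.a : HElt G) := by simp [hypAdd]
  have hcyc : ∀ g, hypEval ρ v
      (cyclicTerm (n (g * ρ 0)) (n (g * ρ 1)) (n (g * ρ 2))) = HElt.a := by
    intro g
    simp only [cyclicTerm, hypEval_add, hypEval_mul, hypEval_var, hv]
    rw [hmul g 0 1 2 (by decide) (by decide) (by decide),
      hmul g 1 2 0 (by decide) (by decide) (by decide),
      hmul g 2 0 1 (by decide) (by decide) (by decide), haa, haa]
  induction l with
  | nil => exact hcyc 1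
  | cons g l ih => rw [lineSum_cons, hypEval_add, hcyc, ih, haa]

end LineSum

end SAlg

/-! ### The five algebras -/

namespace Elt

open SAlg

/-- The embedding of the three-element algebra. -/
def ofFlat : Option Bool → Elt
  | none => infty
  | some true => a
  | some false => one

theorem ofFlat_injective : Function.Injective ofFlat := by
  rintro (_ | _ | _) (_ | _ | _) h <;> first | rfl | cases h

/-- The properties of the five algebras that the proof uses. -/
structure Good (add mul : Elt → Elt → Elt) : Prop where
  ofFlat_add : ∀ c d, ofFlat (flatAdd c d) = add (ofFlat c) (ofFlat d)
  ofFlat_mul : ∀ c d, ofFlat (flatMul c d) = mul (ofFlat c) (ofFlat d)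
  add_eq_a : ∀ x y, add x y = a → x = a ∧ y = a
  add_ne_b : ∀ x y, x ≠ b → y ≠ b → add x y ≠ b
  -- The rotations matter for `S94` and `S117`: a single product can be `b`, from factors `b, 1, 1`
  -- or `1, 1, b` in this order, but then another rotation is `∞`, and `b + ∞ = ∞`.
  cyclic_ne_b : ∀ x y z, add (add (mul x (mul y z)) (mul y (mul z x))) (mul z (mul x y)) ≠ b
  mul_eq_a : ∀ x y z, mul x (mul y z) = a →
    (x = a ∧ y ≠ a ∧ z ≠ a) ∨ (x ≠ a ∧ y = a ∧ z ≠ a) ∨ (x ≠ a ∧ y ≠ a ∧ z = a)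

variable {add mul : Elt → Elt → Elt}

/-- The algebra on `Elt` with the given operations. -/
def alg (add mul : Elt → Elt → Elt) : SAlg := ⟨Elt, add, mul, ⟨infty⟩⟩

theorem Good.satisfies_lineSum (hg : Good add mul) {G : Type} [Group G] [Fintype G]
    {ρ : Fin 3 → G} (h3 : ¬ 3 ∣ Fintype.card G) (n : G → ℕ) :
    (alg add mul).Satisfies (lineSum ρ n Finset.univ.toList,
      (lineSum ρ n Finset.univ.toList).mul (lineSum ρ n Finset.univ.toList)) := by
  classical
  intro (v : ℕ → Elt)
  let ev : Term → Elt := (alg add mul).eval v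
  have hadd : ∀ s t, ev (s.add t) = add (ev s) (ev t) := fun s t => rfl
  have hb : ∀ l, ev (lineSum ρ n l) ≠ b := by
    intro l
    induction l with
    | nil => exact hg.cyclic_ne_b _ _ _
    | cons g l ih =>
      rw [lineSum_cons, hadd]
      exact hg.add_ne_b _ _ (hg.cyclic_ne_b _ _ _) ih
  have ha : ∀ l, ev (lineSum ρ n l) = a → ∀ g ∈ l,
      ev (cyclicTerm (n (g * ρ 0)) (n (g * ρ 1)) (n (g * ρ 2))) = a := by
    intro l hl
    induction l with
    | nil => simp
    | cons g l ih =>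
      rw [lineSum_cons, hadd] at hl
      obtain ⟨h1, h2⟩ := hg.add_eq_a _ _ hl
      intro g' hg'
      rcases List.mem_cons.mp hg' with rfl | hg'
      · exact h1
      · exact ih h2 g' hg'
  have hna : ev (lineSum ρ n Finset.univ.toList) ≠ a := by
    intro hl
    -- If the sum is `a`, so is every summand, and each line has exactly one point whose variable
    -- has the value `a`.
    apply not_forall_exactOn h3 (ρ := ρ) (fun g => decide (v (n g) = a))
    intro g
    have h1 := ha _ hl g (by simp)
    have h2 := hg.mul_eq_a _ _ _ (hg.add_eq_a _ _ (hg.add_eq_a _ _ h1).1).1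
    simp only [eval] at h2
    rcases h2 with ⟨e0, e1, e2⟩ | ⟨e0, e1, e2⟩ | ⟨e0, e1, e2⟩
    · refine ⟨0, decide_eq_true e0, fun i hi => ?_⟩
      fin_cases i
      · rfl
      · exact absurd (of_decide_eq_true hi) e1
      · exact absurd (of_decide_eq_true hi) e2
    · refine ⟨1, decide_eq_true e1, fun i hi => ?_⟩
      fin_cases i
      · exact absurd (of_decide_eq_true hi) e0
      · rfl
      · exact absurd (of_decide_eq_true hi) e2
    · refine ⟨2, decide_eq_true e2, fun i hi => ?_⟩
      fin_cases i
      · exact absurd (of_decide_eq_true hi) e0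
      · exact absurd (of_decide_eq_true hi) e1
      · rfl
  change ev _ = mul (ev _) (ev _)
  have hb' := hb Finset.univ.toList
  generalize ev (lineSum ρ n Finset.univ.toList) = c at *
  cases c with
  | infty => exact hg.ofFlat_mul none none
  | a => exact absurd rfl hna
  | one => exact hg.ofFlat_mul (some false) (some false)
  | b => exact absurd rfl hb'

theorem Good.isNonfinitelyBased (hg : Good add mul) : (alg add mul).IsNonfinitelyBased := by
  rintro ⟨E, hE, hK⟩
  obtain ⟨M, hM⟩ : ∃ M, ∀ e ∈ E, e.1.size + e.2.size ≤ M := by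
    obtain ⟨M, hM⟩ := (hE.image fun e => e.1.size + e.2.size).bddAbove
    exact ⟨M, fun e he => hM ⟨e, he, rfl⟩⟩
  -- `M + 2` rather than `M`, so that relations of length 4 are always excluded, as uniqueness of
  -- lines requires.
  obtain ⟨G, _, _, ρ, hρ, hshort, h3⟩ := exists_involutions_noShortRelation (2 * (M + 2))
  have hflat : flatThree ∈ varietyGen (alg add mul) :=
    (isVariety_varietyGen _).sub _ (mem_varietyGen _) _ ofFlat
      ⟨hg.ofFlat_add, hg.ofFlat_mul⟩ ofFlat_injective
  rw [hK] at hflat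
  have hmem : hypAlg ρ ∈ varietyGen (alg add mul) := by
    rw [hK]
    intro e he
    exact hypAlg_satisfies hshort (by omega) hρ e (hflat e he) ((hM e he).trans (by omega))
  let n : G → ℕ := fun g => Fintype.equivFin G g
  have hn : Function.Injective n := fun x y hxy =>
    (Fintype.equivFin G).injective (Fin.ext hxy)
  let v : ℕ → HElt G := fun k => HElt.x (Function.invFun n k)
  have hv : ∀ g, v (n g) = HElt.x g := fun g => by
    simp only [v, Function.leftInverse_invFun hn g]
  have hsat := (hg.satisfies_lineSum (ρ := ρ) h3 n).of_mem_varietyGen hmem v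
  change hypEval ρ v _ = hypEval ρ v _ at hsat
  rw [hypEval_mul, hypEval_lineSum hshort (by omega) hρ v hv] at hsat
  -- What remains is `a = a * a`, and `a * a` is `∞` in `hypAlg ρ`.
  cases hsat

theorem good_S84 : Good S84.add S84.mul := by
  refine ⟨?_, ?_, ?_, ?_, ?_, ?_⟩
  · rintro (_ | _ | _) (_ | _ | _) <;> rfl
  · rintro (_ | _ | _) (_ | _ | _) <;> rfl
  · intro x y; cases x <;> cases y <;> simp [S84, add₁, tab]
  · intro x y; cases x <;> cases y <;> simp [S84, add₁, tab]
  · intro x y z; cases x <;> cases y <;> cases z <;> simp [S84, add₁, tab]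
  · intro x y z; cases x <;> cases y <;> cases z <;> simp [S84, tab]

theorem good_S94 : Good S94.add S94.mul := by
  refine ⟨?_, ?_, ?_, ?_, ?_, ?_⟩
  · rintro (_ | _ | _) (_ | _ | _) <;> rfl
  · rintro (_ | _ | _) (_ | _ | _) <;> rfl
  · intro x y; cases x <;> cases y <;> simp [S94, add₁, tab]
  · intro x y; cases x <;> cases y <;> simp [S94, add₁, tab]
  · intro x y z; cases x <;> cases y <;> cases z <;> simp [S94, add₁, tab]
  · intro x y z; cases x <;> cases y <;> cases z <;> simp [S94, tab]

theorem good_S117 : Good S117.add S117.mul := by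
  refine ⟨?_, ?_, ?_, ?_, ?_, ?_⟩
  · rintro (_ | _ | _) (_ | _ | _) <;> rfl
  · rintro (_ | _ | _) (_ | _ | _) <;> rfl
  · intro x y; cases x <;> cases y <;> simp [S117, add₁, tab]
  · intro x y; cases x <;> cases y <;> simp [S117, add₁, tab]
  · intro x y z; cases x <;> cases y <;> cases z <;> simp [S117, add₁, tab]
  · intro x y z; cases x <;> cases y <;> cases z <;> simp [S117, tab]

theorem good_S173 : Good S173.add S173.mul := by
  refine ⟨?_, ?_, ?_, ?_, ?_, ?_⟩
  · rintro (_ | _ | _) (_ | _ | _) <;> rfl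
  · rintro (_ | _ | _) (_ | _ | _) <;> rfl
  · intro x y; cases x <;> cases y <;> simp [S173, add₁, tab]
  · intro x y; cases x <;> cases y <;> simp [S173, add₁, tab]
  · intro x y z; cases x <;> cases y <;> cases z <;> simp [S173, add₁, tab]
  · intro x y z; cases x <;> cases y <;> cases z <;> simp [S173, tab]

theorem good_S282 : Good S282.add S282.mul := by
  refine ⟨?_, ?_, ?_, ?_, ?_, ?_⟩
  · rintro (_ | _ | _) (_ | _ | _) <;> rfl
  · rintro (_ | _ | _) (_ | _ | _) <;> rfl
  · intro x y; cases x <;> cases y <;> simp [S282, add₂, tab]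
  · intro x y; cases x <;> cases y <;> simp [S282, add₂, tab]
  · intro x y z; cases x <;> cases y <;> cases z <;> simp [S282, add₂, tab]
  · intro x y z; cases x <;> cases y <;> cases z <;> simp [S282, tab]

end Elt

theorem mainTheorem10 :
    ∀ S ∈ ({Elt.S84, Elt.S94, Elt.S117, Elt.S173, Elt.S282} : Set SAlg),
      S.IsAiSemiring ∧ S.IsNonfinitelyBased := by
  rintro S (rfl | rfl | rfl | rfl | rfl)
  · refine ⟨⟨?_, ?_, ?_, ?_, ?_, ?_⟩, Elt.good_S84.isNonfinitelyBased⟩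
    · rintro (_ | _ | _ | _) (_ | _ | _ | _) (_ | _ | _ | _) <;> rfl
    · rintro (_ | _ | _ | _) (_ | _ | _ | _) <;> rfl
    · rintro (_ | _ | _ | _) <;> rfl
    all_goals rintro (_ | _ | _ | _) (_ | _ | _ | _) (_ | _ | _ | _) <;> rfl
  · refine ⟨⟨?_, ?_, ?_, ?_, ?_, ?_⟩, Elt.good_S94.isNonfinitelyBased⟩
    · rintro (_ | _ | _ | _) (_ | _ | _ | _) (_ | _ | _ | _) <;> rfl
    · rintro (_ | _ | _ | _) (_ | _ | _ | _) <;> rfl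
    · rintro (_ | _ | _ | _) <;> rfl
    all_goals rintro (_ | _ | _ | _) (_ | _ | _ | _) (_ | _ | _ | _) <;> rfl
  · refine ⟨⟨?_, ?_, ?_, ?_, ?_, ?_⟩, Elt.good_S117.isNonfinitelyBased⟩
    · rintro (_ | _ | _ | _) (_ | _ | _ | _) (_ | _ | _ | _) <;> rfl
    · rintro (_ | _ | _ | _) (_ | _ | _ | _) <;> rfl
    · rintro (_ | _ | _ | _) <;> rfl
    all_goals rintro (_ | _ | _ | _) (_ | _ | _ | _) (_ | _ | _ | _) <;> rfl
  · refine ⟨⟨?_, ?_, ?_, ?_, ?_, ?_⟩, Elt.good_S173.isNonfinitelyBased⟩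
    · rintro (_ | _ | _ | _) (_ | _ | _ | _) (_ | _ | _ | _) <;> rfl
    · rintro (_ | _ | _ | _) (_ | _ | _ | _) <;> rfl
    · rintro (_ | _ | _ | _) <;> rfl
    all_goals rintro (_ | _ | _ | _) (_ | _ | _ | _) (_ | _ | _ | _) <;> rfl
  · refine ⟨⟨?_, ?_, ?_, ?_, ?_, ?_⟩, Elt.good_S282.isNonfinitelyBased⟩
    · rintro (_ | _ | _ | _) (_ | _ | _ | _) (_ | _ | _ | _) <;> rfl
    · rintro (_ | _ | _ | _) (_ | _ | _ | _) <;> rfl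
    · rintro (_ | _ | _ | _) <;> rfl
    all_goals rintro (_ | _ | _ | _) (_ | _ | _ | _) (_ | _ | _ | _) <;> rfl
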